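/- Let $p$ be an odd prime and let $n_1$ be a positive integer coprime to $p$. Let $m$ be the least positive integer such that $p^m\equiv 1\pmod{n_1}$, and put $q=p^m$ and $N=\frac{q-1}{n_1}$. Let $\alpha$ be a primitive element of $\mathbb{F}_q$ and put $\theta=\alpha^N$. Let $\mathrm{Tr}$ be the trace from $\mathbb{F}_q$ to $\mathbb{F}_p$, and let $$C_D=\{(\mathrm{Tr}(a),\mathrm{Tr}(a\theta),\dots,\mathrm{Tr}(a\theta^{n_1-1})) : a\in\mathbb{F}_q\}\subseteq\mathbb{F}_p^{n_1}$$ be the linear code with defining set $D=\{\theta^i : 0\le i<n_1\}$. For an $\mathbb{F}_p$-linear code $C$ and $1\le r\le\dim C$, let $$d_r(C)=\min\{|\mathrm{Supp}(U)| : U\subseteq C \text{ an } \mathbb{F}_p\text{-subspace},\ \dim U=r\}$$ be its $r$-th generalized Hamming weight, where $\mathrm{Supp}(U)$ is the set of coordinates at which some element of $U$ is nonzero. Suppose that $N_1:=\gcd\left(N,\frac{q-1}{p-1}\right)=3$, that $p\equiv 2\pmod 3$, and that $4l\mid m$ for an odd positive integer $l$. Then for all $1\le r\le l$, $$d_r(C_D)=\left(1-\frac{1}{p^r}\right)\frac{q-\sqrt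 q}{N}.$$ -/

import Mathlib

/-- The support of a linear code `U`: the coordinates at which some word of `U` is nonzero. -/
def codeSupport {K : Type*} [Field K] {n : ℕ} (U : Submodule K (Fin n → K)) : Set (Fin n) :=
  {i | ∃ x ∈ U, x i ≠ 0}

/-- The `r`-th generalized Hamming weight of a linear code `C` of length `n`: the least support
size of an `r`-dimensional subspace of `C`. It is an attained minimum for every `r` up to the
dimension of `C`, see `genHammingWeight_isLeast`. -/
noncomputable def genHammingWeight {K : Type*} [Field K] {n : ℕ}
    (C : Submodule K (Fin n → K)) (r : ℕ) : ℕ :=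
  sInf {s : ℕ | ∃ U : Submodule K (Fin n → K),
    U ≤ C ∧ Module.finrank K U = r ∧ (codeSupport U).ncard = s}

theorem genHammingWeight_isLeast {K : Type*} [Field K] {n : ℕ}
    (C : Submodule K (Fin n → K)) (r : ℕ) (hr : r ≤ Module.finrank K C) :
    IsLeast {s : ℕ | ∃ U : Submodule K (Fin n → K),
      U ≤ C ∧ Module.finrank K U = r ∧ (codeSupport U).ncard = s} (genHammingWeight C r) := by
  refine ⟨Nat.sInf_mem ?_, fun s hs => Nat.sInf_le hs⟩
  obtain ⟨f, hf⟩ := exists_linearIndependent_of_le_finrank hr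
  refine ⟨_, (Submodule.span K (Set.range f)).map C.subtype, Submodule.map_subtype_le _ _, ?_, rfl⟩
  rw [Submodule.finrank_map_subtype_eq, finrank_span_eq_card hf,
    Fintype.card_fin]

/-- The code `C_D = {(Tr(a d_1), …, Tr(a d_n)) : a ∈ F}` over `K` with defining set
`D = {d_1, …, d_n} ⊆ F`, where `Tr` is the trace from `F` to `K`. -/
noncomputable def traceCode (K : Type*) {F : Type*} [Field K] [Field F] [Algebra K F] {n : ℕ}
    (d : Fin n → F) : Submodule K (Fin n → K) :=
  LinearMap.range
    (LinearMap.pi fun i => (Algebra.trace K F).comp (LinearMap.mulRight K (d i)))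

theorem mem_traceCode {K F : Type*} [Field K] [Field F] [Algebra K F] {n : ℕ}
    (d : Fin n → F) (x : Fin n → K) :
    x ∈ traceCode K d ↔ ∃ a : F, x = fun i => Algebra.trace K F (a * d i) := by
  simp only [traceCode, LinearMap.mem_range, eq_comm (b := x)]
  exact Iff.rfl

open Finset

/-! The powers of `θ` together with the prime field generate the nonzero cubes of `F`, so the weight
of the word of `a` is governed by the number of zeros of `Tr(a y³)`, hence by the cubic sum of `a`
(`mul_card_trace_ne_zero_add_cubicZeros`, `sub_one_mul_cubicSum`). Since `p ≡ 2 [MOD 3]`, Frobenius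
swaps the two classes of noncubes, so this sum takes one value on nonzero cubes and one on noncubes.
Its first two moments determine both values up to a common sign, and a count modulo 3 fixes the
sign: `-2√q` and `√q` (`cubicSum_values`). Thus noncubes give exactly the words of minimal weight.

Summing weights over a subspace `U` counts each supported coordinate equally often, so the minimal
weight bounds the support from below, with equality if all nonzero words of `U` are minimal. A
translate of the subfield of order `p ^ l` by a noncube supplies such a `U` for `r ≤ l`: as `l` is
odd, every element of that subfield is a cube (`exists_submodule_not_cube`). -/

/-- Two homomorphisms with the same range average a function equally. -/
theorem card_mul_sum_comp_eq_of_range_eq {A B G R : Type*} [Group A] [Group B] [Group G]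
    [Fintype A] [Fintype B] [CommSemiring R] (f : A →* G) (g : B →* G) (hfg : f.range = g.range)
    (h : G → R) :
    (Fintype.card B : R) * ∑ a, h (f a) = Fintype.card A * ∑ b, h (g b) := by
  have h1 : ∀ b, ∑ a, h (f a * g b) = ∑ a, h (f a) := fun b => by
    obtain ⟨c, hc⟩ : g b ∈ f.range := hfg ▸ ⟨b, rfl⟩
    simp_rw [← hc, ← map_mul]
    exact Equiv.sum_comp (Equiv.mulRight c) fun a => h (f a)
  have h2 : ∀ a, ∑ b, h (f a * g b) = ∑ b, h (g b) := fun a => by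
    obtain ⟨c, hc⟩ : f a ∈ g.range := hfg ▸ ⟨a, rfl⟩
    simp_rw [← hc, ← map_mul]
    exact Equiv.sum_comp (Equiv.mulLeft c) fun b => h (g b)
  calc _ = ∑ b, ∑ a, h (f a * g b) := by simp [h1]
    _ = ∑ a, ∑ b, h (f a * g b) := sum_comm
    _ = _ := by simp [h2]

/-- In a finite field whose unit group has order prime to `n`, every element is an `n`-th power. -/
theorem exists_pow_eq_of_coprime_card {E : Type*} [Field E] {n : ℕ} (hn : n ≠ 0)
    (h : (Nat.card Eˣ).Coprime n) (x : E) : ∃ y, y ^ n = x := by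
  rcases eq_or_ne x 0 with rfl | hx
  · exact ⟨0, zero_pow hn⟩
  · obtain ⟨y, hy⟩ := (powCoprime h).surjective (Units.mk0 x hx)
    exact ⟨y, by simpa using congrArg Units.val hy⟩

/-! ### Cubic exponential sums and their two values. -/

section CubicSum

variable (p : ℕ) [Fact p.Prime] {F : Type*} [Field F] [Fintype F] [Algebra (ZMod p) F]

/-- The cubic exponential sum `∑ ψ(Tr(a y³))`, with `ψ` the standard character of `ZMod p`. -/
noncomputable def cubicSum (a : F) : ℂ :=
  ∑ y : F, ZMod.stdAddChar (Algebra.trace (ZMod p) F (a * y ^ 3))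

/-- The number of `y` with `Tr(a y³) = 0`. -/
noncomputable def cubicZeros (a : F) : ℕ :=
  #{y : F | Algebra.trace (ZMod p) F (a * y ^ 3) = 0}

theorem sum_stdAddChar_trace_mul [DecidableEq F] (b : F) :
    ∑ a : F, ZMod.stdAddChar (Algebra.trace (ZMod p) F (a * b)) =
      if b = 0 then (Fintype.card F : ℂ) else 0 := by
  have hne : (ZMod.stdAddChar (N := p)).compAddMonoidHom
      (Algebra.trace (ZMod p) F).toAddMonoidHom ≠ 1 := by
    intro h
    obtain ⟨a, ha⟩ := Algebra.trace_surjective (ZMod p) F 1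
    have h1 := DFunLike.congr_fun h a
    have h2 : ZMod.stdAddChar (1 : ZMod p) = ZMod.stdAddChar (0 : ZMod p) := by
      simpa [ha] using h1
    exact one_ne_zero (ZMod.injective_stdAddChar h2)
  have := AddChar.sum_mulShift b (AddChar.IsPrimitive.of_ne_one hne)
  simpa using this

theorem cubicSum_mul_cube (a : F) {b : F} (hb : b ≠ 0) :
    cubicSum p (a * b ^ 3) = cubicSum p a := by
  unfold cubicSum
  rw [← Equiv.sum_comp (Equiv.mulLeft₀ b hb)
    fun y => ZMod.stdAddChar (Algebra.trace (ZMod p) F (a * y ^ 3))]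
  simp [mul_pow, mul_assoc]

theorem cubicSum_zero : cubicSum p (0 : F) = Fintype.card F := by
  simp [cubicSum]

/-- The trace is Frobenius-invariant. This is what identifies the two noncube classes. -/
theorem cubicSum_pow_char (a : F) : cubicSum p (a ^ p) = cubicSum p a := by
  unfold cubicSum
  let e := FiniteField.frobeniusAlgEquivOfAlgebraic (ZMod p) F
  have he : ∀ x, e x = x ^ p := fun x => by
    simp [e]
  rw [← Equiv.sum_comp e.toEquiv]
  refine sum_congr rfl fun y _ => ?_
  have : a ^ p * (e.toEquiv y) ^ 3 = e (a * y ^ 3) := by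
    simp [he]
    ring
  rw [this, Algebra.trace_eq_of_algEquiv]

theorem sum_cubicSum : ∑ a : F, cubicSum p a = Fintype.card F := by
  classical
  unfold cubicSum
  rw [sum_comm]
  simp [sum_stdAddChar_trace_mul]

/-- By orthogonality this counts the solutions of `y³ + z³ = 0`: three `z` for each nonzero `y`, one
for `y = 0`. -/
theorem sum_cubicSum_sq (h3 : 3 ∣ Fintype.card F - 1) :
    ∑ a : F, cubicSum p a ^ 2 = Fintype.card F * (1 + 3 * (Fintype.card F - 1)) := by
  classical
  have hker : #{u : Fˣ | u ^ 3 = 1} = 3 := by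
    have := IsCyclic.card_powMonoidHom_ker Fˣ 3
    rw [Nat.card_eq_fintype_card (α := Fˣ), Fintype.card_units, Nat.gcd_eq_right h3] at this
    rw [← Fintype.card_subtype, ← Nat.card_eq_fintype_card]
    exact this
  have hcount : ∀ y : F, y ≠ 0 → #{z : F | y ^ 3 + z ^ 3 = 0} = 3 := by
    intro y hy
    refine Eq.trans (Eq.symm ?_) hker
    refine card_bij (fun u _ => -y * (u : F)) ?_ ?_ ?_
    · intro u hu
      have : (u : F) ^ 3 = 1 := by simpa [Units.ext_iff] using hu
      simp only [mem_filter, mem_univ, true_and]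
      linear_combination (-y ^ 3) * this
    · intro u _ v _ huv
      exact Units.ext (mul_left_cancel₀ (neg_ne_zero.2 hy) huv)
    · intro z hz
      simp only [mem_filter, mem_univ, true_and] at hz
      have hz0 : z ≠ 0 := by
        rintro rfl
        exact hy (by simpa using hz)
      refine ⟨Units.mk0 (-z / y) (by simp [hz0, hy]), ?_, ?_⟩
      · simp only [mem_filter, mem_univ, true_and, Units.ext_iff, Units.val_pow_eq_pow_val,
          Units.val_mk0, Units.val_one]
        field_simp
        linear_combination -hz
      · simp
        field_simp
  have hcount0 : #{z : F | (0 : F) ^ 3 + z ^ 3 = 0} = 1 := by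
    rw [card_eq_one]
    exact ⟨0, by ext; simp⟩
  have h1 : ∀ a : F, cubicSum p a ^ 2 =
      ∑ y : F, ∑ z : F, ZMod.stdAddChar (Algebra.trace (ZMod p) F (a * (y ^ 3 + z ^ 3))) := by
    intro a
    simp only [cubicSum, sq, sum_mul_sum, mul_add, map_add, AddChar.map_add_eq_mul]
  simp_rw [h1]
  rw [sum_comm]
  have h2 : ∀ y : F, ∑ a : F, ∑ z : F,
      ZMod.stdAddChar (Algebra.trace (ZMod p) F (a * (y ^ 3 + z ^ 3))) =
        (Fintype.card F : ℂ) * (#{z : F | y ^ 3 + z ^ 3 = 0} : ℕ) := by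
    intro y
    rw [sum_comm]
    simp_rw [sum_stdAddChar_trace_mul]
    rw [← sum_filter, sum_const, nsmul_eq_mul, mul_comm]
  simp_rw [h2]
  rw [← mul_sum, ← add_sum_erase _ _ (mem_univ (0 : F)), hcount0,
    sum_congr rfl fun y hy => by rw [hcount y (ne_of_mem_erase hy)]]
  simp [card_erase_of_mem, Nat.cast_sub Fintype.card_pos]
  ring_nf

theorem sub_one_mul_cubicSum (hp : p ≡ 2 [MOD 3]) (a : F) :
    ((p : ℂ) - 1) * cubicSum p a = p * cubicZeros p a - Fintype.card F := by
  classical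
  have hcop : (Nat.card (ZMod p)ˣ).Coprime 3 := by
    rw [Nat.card_eq_fintype_card, ZMod.card_units, Nat.coprime_comm,
      Nat.Prime.coprime_iff_not_dvd Nat.prime_three]
    have := (Fact.out : p.Prime).pos
    have := hp
    unfold Nat.ModEq at this
    omega
  have h1 : ∀ c : ZMod p, ∑ y : F,
      ZMod.stdAddChar (c * Algebra.trace (ZMod p) F (a * y ^ 3)) =
        if c = 0 then (Fintype.card F : ℂ) else cubicSum p a := by
    intro c
    split_ifs with hc
    · simp [hc]
    -- Every scalar of the prime field is a cube, so it can be absorbed into `y`.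
    · obtain ⟨e, rfl⟩ := exists_pow_eq_of_coprime_card three_ne_zero hcop c
      have he : algebraMap (ZMod p) F e ≠ 0 := by
        simpa using fun h : e = 0 => hc (by simp [h])
      rw [← cubicSum_mul_cube p a he, cubicSum]
      refine sum_congr rfl fun y _ => ?_
      rw [← smul_eq_mul (e ^ 3), ← map_smul, Algebra.smul_def, map_pow]
      ring_nf
  have h2 : ∑ c : ZMod p, ∑ y : F, ZMod.stdAddChar (c * Algebra.trace (ZMod p) F (a * y ^ 3)) =
      (p : ℂ) * cubicZeros p a := by
    rw [sum_comm]
    simp_rw [AddChar.sum_mulShift _ (ZMod.isPrimitive_stdAddChar p)]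
    simp [cubicZeros, ← sum_filter, mul_comm, ZMod.card]
  simp_rw [h1] at h2
  rw [← add_sum_erase _ _ (mem_univ (0 : ZMod p)),
    sum_congr rfl fun c hc => if_neg (ne_of_mem_erase hc)] at h2
  simp [card_erase_of_mem, ZMod.card, Nat.cast_sub (Fact.out : p.Prime).pos] at h2
  linear_combination h2

/-- A primitive cube root of unity acts on the zeros by multiplication, fixing only `y = 0`. -/
theorem cubicZeros_modEq (h3 : 3 ∣ Fintype.card F - 1) (a : F) : cubicZeros p a ≡ 1 [MOD 3] := by
  classical
  obtain ⟨ω, hω⟩ := exists_prime_orderOf_dvd_card' (G := Fˣ) 3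
    (by rwa [Nat.card_eq_fintype_card, Fintype.card_units])
  have hω3 : (ω : F) ^ 3 = 1 := by
    rw [← Units.val_pow_eq_pow_val, ← hω, pow_orderOf_eq_one, Units.val_one]
  have hω1 : (ω : F) ≠ 1 := by
    intro h
    rw [Units.val_eq_one] at h
    simp [h] at hω
  let T := {y : F // Algebra.trace (ZMod p) F (a * y ^ 3) = 0}
  let f : Function.End T := fun y => ⟨ω * y, by rw [mul_pow, hω3, one_mul]; exact y.2⟩
  have hf : f ^ 3 ^ 1 = 1 := by
    funext y
    apply Subtype.ext
    change (ω : F) * (ω * (ω * y)) = y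
    linear_combination (y : F) * hω3
  have hfix : Fintype.card (Function.fixedPoints f) = 1 := by
    rw [Fintype.card_eq_one_iff]
    refine ⟨⟨⟨0, by simp⟩, Subtype.ext (by simp [f])⟩, fun y => ?_⟩
    have hy : (ω : F) * y.1.1 = y.1.1 := congrArg Subtype.val y.2
    have : ((ω : F) - 1) * y.1.1 = 0 := by linear_combination hy
    exact Subtype.ext (Subtype.ext
      ((mul_eq_zero.1 this).resolve_left (sub_ne_zero.2 hω1)))
  have := Equiv.Perm.card_fixedPoints_modEq hf
  rwa [hfix, Fintype.card_subtype] at this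

theorem sum_units_eq_sum_sub [DecidableEq F] {R : Type*} [AddCommGroup R] (g : F → R) :
    ∑ u : Fˣ, g u = ∑ a, g a - g 0 := by
  rw [eq_sub_iff_add_eq', ← add_sum_erase _ _ (mem_univ (0 : F))]
  congr 1
  refine sum_bij (fun u _ => (u : F)) (by simp) (fun _ _ _ _ h => Units.ext h) ?_ (by simp)
  exact fun b hb => ⟨Units.mk0 b (ne_of_mem_erase hb), mem_univ _, rfl⟩

theorem exists_eq_npow {α : Fˣ} (hα : ∀ x : Fˣ, x ∈ Subgroup.zpowers α) (u : Fˣ) :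
    ∃ j : ℕ, u = α ^ j := by
  obtain ⟨j, hj⟩ := (mem_powers_iff_mem_zpowers).2 (hα u)
  exact ⟨j, hj.symm⟩

/-- Among `u`, `α u`, `α² u` exactly one is an `α`-power with exponent divisible by 3. -/
theorem three_mul_sum_units [DecidableEq F] {α : Fˣ} (hα : ∀ x : Fˣ, x ∈ Subgroup.zpowers α) {g : Fˣ → ℂ}
    {c₀ c₁ : ℂ} (hg : ∀ j : ℕ, g (α ^ j) = if 3 ∣ j then c₀ else c₁) :
    3 * ∑ u, g u = ((Fintype.card F : ℂ) - 1) * (c₀ + 2 * c₁) := by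
  have h1 : ∑ u, g (α * u) = ∑ u, g u := Equiv.sum_comp (Equiv.mulLeft α) g
  have h2 : ∑ u, g (α ^ 2 * u) = ∑ u, g u := Equiv.sum_comp (Equiv.mulLeft (α ^ 2)) g
  have h3 : ∀ u, g u + g (α * u) + g (α ^ 2 * u) = c₀ + 2 * c₁ := by
    intro u
    obtain ⟨j, rfl⟩ := exists_eq_npow hα u
    rw [← pow_succ', ← pow_add, hg, hg, hg]
    obtain h | h | h : j % 3 = 0 ∨ j % 3 = 1 ∨ j % 3 = 2 := by omega
    · rw [if_pos (by omega), if_neg (by omega), if_neg (by omega)]; ring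
    · rw [if_neg (by omega), if_neg (by omega), if_pos (by omega)]; ring
    · rw [if_neg (by omega), if_pos (by omega), if_neg (by omega)]; ring
  calc 3 * ∑ u, g u = ∑ u, (g u + g (α * u) + g (α ^ 2 * u)) := by
        rw [sum_add_distrib, sum_add_distrib, h1, h2]; ring
    _ = _ := by
        simp [h3, Fintype.card_units, Nat.cast_sub Fintype.card_pos]
        ring

variable {p}

theorem cubicSum_pow (hp : p ≡ 2 [MOD 3]) (α : Fˣ) (j : ℕ) :
    cubicSum p ((α ^ j : Fˣ) : F) =
      if 3 ∣ j then cubicSum p (1 : F) else cubicSum p (α : F) := by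
  have hne : ∀ k : ℕ, (α : F) ^ k ≠ 0 := fun k => pow_ne_zero k α.ne_zero
  have hp' : p % 3 = 2 := hp
  rw [Units.val_pow_eq_pow_val]
  split_ifs with h
  · obtain ⟨k, rfl⟩ := h
    rw [← cubicSum_mul_cube p 1 (hne k), one_mul, ← pow_mul, mul_comm]
  · obtain h | h : j % 3 = 1 ∨ j % 3 = 2 := by omega
    · rw [← cubicSum_mul_cube p (α : F) (hne (j / 3)), ← pow_mul, ← pow_succ']
      congr 2
      omega
    -- As `p` and `j` are both 2 modulo 3, `α ^ p` and `α ^ j` differ by a cube.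
    · rw [← cubicSum_pow_char p (α : F), ← cubicSum_mul_cube p ((α : F) ^ j) (hne (p / 3)),
        ← cubicSum_mul_cube p ((α : F) ^ p) (hne (j / 3)), ← pow_mul, ← pow_mul, ← pow_add,
        ← pow_add]
      congr 2
      omega

theorem cubicSum_values (hp : p ≡ 2 [MOD 3]) {Q : ℕ} (hQ : Fintype.card F = Q ^ 2)
    (hQ3 : Q ≡ 1 [MOD 3]) {α : Fˣ} (hα : ∀ x : Fˣ, x ∈ Subgroup.zpowers α) :
    cubicSum p (1 : F) = -2 * Q ∧ cubicSum p (α : F) = Q := by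
  classical
  have h3 : 3 ∣ Fintype.card F - 1 := by
    rw [hQ]
    exact (Nat.modEq_iff_dvd' (hQ ▸ Fintype.card_pos)).1 (by simpa using (hQ3.pow 2).symm)
  have hq1 : ((Fintype.card F : ℂ) - 1) ≠ 0 := by
    rw [sub_ne_zero]
    exact_mod_cast Fintype.one_lt_card.ne'
  have e1 := three_mul_sum_units hα (g := fun u => cubicSum p (u : F))
    fun j => cubicSum_pow hp α j
  rw [sum_units_eq_sum_sub, sum_cubicSum, cubicSum_zero, sub_self, mul_zero, eq_comm,
    mul_eq_zero] at e1
  have e1' := e1.resolve_left hq1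
  have e2 := three_mul_sum_units hα (g := fun u => cubicSum p (u : F) ^ 2)
    (c₀ := cubicSum p (1 : F) ^ 2) (c₁ := cubicSum p (α : F) ^ 2) fun j => by
      rw [cubicSum_pow hp α j]
      split_ifs <;> rfl
  rw [sum_units_eq_sum_sub (fun a : F => cubicSum p a ^ 2), sum_cubicSum_sq p h3,
    cubicSum_zero] at e2
  have e0 : cubicSum p (1 : F) = -2 * cubicSum p (α : F) := by linear_combination e1'
  have e3 : cubicSum p (α : F) ^ 2 = (Q : ℂ) ^ 2 := by
    have hc : (Fintype.card F : ℂ) = (Q : ℂ) ^ 2 := by exact_mod_cast hQ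
    rw [← hc]
    rw [e0] at e2
    refine mul_left_cancel₀ hq1 ?_
    linear_combination (-1 / 6 : ℂ) * e2
  -- The value `-Q` is excluded modulo 3: the zero-count identity would read `-1 = 2 - 1`.
  have e4 : cubicSum p (α : F) = Q := by
    refine (sq_eq_sq_iff_eq_or_eq_neg.1 e3).resolve_right fun h => ?_
    have h1 := sub_one_mul_cubicSum p hp (α : F)
    rw [h, hQ] at h1
    have h2 : ((p : ℤ) - 1) * (-Q) = p * cubicZeros p (α : F) - (Q : ℤ) ^ 2 := by
      exact_mod_cast h1
    have h5 := congrArg (Int.cast : ℤ → ZMod 3) h2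
    have hz := (ZMod.natCast_eq_natCast_iff _ _ 3).2 (cubicZeros_modEq p h3 (α : F))
    have hp3 := (ZMod.natCast_eq_natCast_iff _ _ 3).2 hp
    have hQ3' := (ZMod.natCast_eq_natCast_iff _ _ 3).2 hQ3
    push_cast at h5 hz hp3 hQ3'
    rw [hz, hp3, hQ3'] at h5
    revert h5
    decide
  exact ⟨by rw [e0, e4], e4⟩

theorem mul_cubicZeros_of_not_cube (hp : p ≡ 2 [MOD 3]) {Q : ℕ} (hQ : Fintype.card F = Q ^ 2)
    (hQ3 : Q ≡ 1 [MOD 3]) {α : Fˣ} (hα : ∀ x : Fˣ, x ∈ Subgroup.zpowers α) {a : F}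
    (ha : ¬ ∃ b, b ^ 3 = a) :
    (p : ℤ) * cubicZeros p a = (Q : ℤ) ^ 2 + (p - 1) * Q := by
  have ha0 : a ≠ 0 := by
    rintro rfl
    exact ha ⟨0, by simp⟩
  obtain ⟨j, hj⟩ := exists_eq_npow hα (Units.mk0 a ha0)
  have hj' : a = ((α ^ j : Fˣ) : F) := congrArg Units.val hj
  have h1 := sub_one_mul_cubicSum p hp a
  rw [hj', cubicSum_pow hp, if_neg, (cubicSum_values hp hQ hQ3 hα).2, hQ] at h1
  · have h2 : ((p : ℤ) - 1) * Q = p * cubicZeros p ((α ^ j : Fˣ) : F) - (Q : ℤ) ^ 2 := by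
      exact_mod_cast h1
    rw [hj']
    linear_combination -h2
  · rintro ⟨k, rfl⟩
    exact ha ⟨(α : F) ^ k, by rw [hj', ← pow_mul, mul_comm, Units.val_pow_eq_pow_val]⟩

theorem mul_cubicZeros_le (hp : p ≡ 2 [MOD 3]) {Q : ℕ} (hQ : Fintype.card F = Q ^ 2)
    (hQ3 : Q ≡ 1 [MOD 3]) {α : Fˣ} (hα : ∀ x : Fˣ, x ∈ Subgroup.zpowers α) {a : F}
    (ha : a ≠ 0) :
    (p : ℤ) * cubicZeros p a ≤ (Q : ℤ) ^ 2 + (p - 1) * Q := by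
  by_cases hc : ∃ b, b ^ 3 = a
  · obtain ⟨b, rfl⟩ := hc
    have hb : b ≠ 0 := fun h => ha (by simp [h])
    have h1 := sub_one_mul_cubicSum p hp (b ^ 3)
    rw [← one_mul (b ^ 3), cubicSum_mul_cube p 1 hb, (cubicSum_values hp hQ hQ3 hα).1, hQ,
      one_mul] at h1
    have h2 : ((p : ℤ) - 1) * (-2 * Q) = p * cubicZeros p (b ^ 3) - (Q : ℤ) ^ 2 := by
      exact_mod_cast h1
    have h3 : (0 : ℤ) ≤ ((p : ℤ) - 1) * Q :=
      mul_nonneg (by have := (Fact.out : p.Prime).pos; omega) (by positivity)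
    linarith
  · exact (mul_cubicZeros_of_not_cube hp hQ hQ3 hα hc).le
end CubicSum

/-! ### Weights of codewords. -/

/-- The Hamming weights of the words `(Tr(a θ^i))` in terms of the zeros of `Tr(a y³)`: the powers
of `θ` together with the prime field generate the group of nonzero cubes. -/
theorem mul_card_trace_ne_zero_add_cubicZeros {p : ℕ} [Fact p.Prime] {F : Type*} [Field F]
    [Fintype F] [Algebra (ZMod p) F] (hp : p ≡ 2 [MOD 3]) {n N : ℕ} (hn : 0 < n)
    (hnN : n * N = Fintype.card F - 1) {α : Fˣ} (hα : ∀ x : Fˣ, x ∈ Subgroup.zpowers α)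
    (hgcd : N.gcd ((Fintype.card F - 1) / (p - 1)) = 3) (a : F) :
    N * #{i : Fin n | Algebra.trace (ZMod p) F (a * ((α : F) ^ N) ^ (i : ℕ)) ≠ 0} +
      cubicZeros p a = Fintype.card F := by
  classical
  have hp1 : 1 < p := (Fact.out : p.Prime).one_lt
  have hp' : p % 3 = 2 := hp
  have hcop : (Nat.card (ZMod p)ˣ).Coprime 3 := by
    rw [Nat.card_eq_fintype_card, ZMod.card_units, Nat.coprime_comm,
      Nat.Prime.coprime_iff_not_dvd Nat.prime_three]
    omega
  have hN0 : 0 < N := by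
    have := Fintype.one_lt_card (α := F)
    exact Nat.pos_of_mul_pos_left (by omega : 0 < n * N)
  have hord : orderOf α = n * N := by
    rw [hnN, ← Fintype.card_units, ← Nat.card_eq_fintype_card]
    exact orderOf_eq_card_of_forall_mem_zpowers hα
  have hordN : orderOf (α ^ N) = n := by
    rw [orderOf_pow, hord, Nat.gcd_mul_left_left, Nat.mul_div_cancel _ hN0]
  let f : Fˣ →* Fˣ := powMonoidHom 3
  let g : Subgroup.zpowers (α ^ N) × (ZMod p)ˣ →* Fˣ :=
    (Subgroup.zpowers (α ^ N)).subtype.coprod (Units.map (algebraMap (ZMod p) F).toMonoidHom)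
  have hfg : f.range = g.range := by
    apply le_antisymm
    · rintro _ ⟨u, rfl⟩
      obtain ⟨j, rfl⟩ := exists_eq_npow hα u
      have hnorm : Units.map (algebraMap (ZMod p) F).toMonoidHom
          (Units.map (Algebra.norm (ZMod p)) α) =
            α ^ ((Fintype.card F - 1) / (p - 1)) := by
        apply Units.ext
        have := FiniteField.algebraMap_norm_eq_pow (K := ZMod p) (x := (α : F))
        simpa [Nat.card_eq_fintype_card, ZMod.card] using this
      -- Bézout writes `α ^ 3` as a power of `α ^ N` times a power of the norm of `α`, which lies in
      -- the prime field.
      have hbez := Nat.gcd_eq_gcd_ab N ((Fintype.card F - 1) / (p - 1))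
      rw [hgcd] at hbez
      have h3 : α ^ 3 ∈ g.range := by
        have : α ^ 3 = (α ^ N) ^ (N.gcdA ((Fintype.card F - 1) / (p - 1))) *
            (α ^ ((Fintype.card F - 1) / (p - 1))) ^
              (N.gcdB ((Fintype.card F - 1) / (p - 1))) := by
          rw [← zpow_natCast α N, ← zpow_natCast α ((Fintype.card F - 1) / (p - 1)), ← zpow_mul,
            ← zpow_mul, ← zpow_add, ← hbez, ← zpow_natCast]
        rw [this, ← hnorm]
        exact mul_mem
          (zpow_mem (MonoidHom.mem_range.2
            ⟨(⟨α ^ N, Subgroup.mem_zpowers _⟩, 1), by simp [g]⟩) _)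
          (zpow_mem (MonoidHom.mem_range.2
            ⟨(1, Units.map (Algebra.norm (ZMod p)) α), by simp [g]⟩) _)
      change (α ^ j) ^ 3 ∈ g.range
      rw [← pow_mul, mul_comm, pow_mul]
      exact pow_mem h3 j
    · rintro _ ⟨⟨⟨x, hx⟩, c⟩, rfl⟩
      obtain ⟨d, hd⟩ := (powCoprime hcop).surjective c
      obtain ⟨k, rfl⟩ := hx
      obtain ⟨N', hN'⟩ : 3 ∣ N := hgcd ▸ Nat.gcd_dvd_left _ _
      refine mul_mem ⟨(α ^ N') ^ k, ?_⟩ ⟨Units.map (algebraMap (ZMod p) F).toMonoidHom d, ?_⟩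
      · change ((α ^ N') ^ k) ^ 3 = (α ^ N) ^ k
        rw [hN', ← zpow_natCast, zpow_comm, zpow_natCast, ← pow_mul, mul_comm]
      · rw [← hd]
        simp [f, powCoprime_apply]
  let h : Fˣ → ℤ := fun x => if Algebra.trace (ZMod p) F (a * x) = 0 then 0 else 1
  have key := card_mul_sum_comp_eq_of_range_eq f g hfg h
  have hA : ∑ u, h (f u) = (Fintype.card F : ℤ) - cubicZeros p a := by
    have h1 := sum_units_eq_sum_sub
      fun y : F => if Algebra.trace (ZMod p) F (a * y ^ 3) = 0 then (0 : ℤ) else 1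
    have h2 := card_filter_add_card_filter_not (s := (univ : Finset F))
      fun y : F => Algebra.trace (ZMod p) F (a * y ^ 3) = 0
    have h3 : ∑ y : F, (if Algebra.trace (ZMod p) F (a * y ^ 3) = 0 then (0 : ℤ) else 1) =
        #{y : F | ¬ Algebra.trace (ZMod p) F (a * y ^ 3) = 0} := by
      simp [card_filter, ite_not]
    simp only [h, f, powMonoidHom_apply, Units.val_pow_eq_pow_val]
    rw [h1, h3, cubicZeros, ← card_univ, ← h2]
    simp
  have hB : ∑ b, h (g b) = ((p : ℤ) - 1) *
      #{i : Fin n | Algebra.trace (ZMod p) F (a * ((α : F) ^ N) ^ (i : ℕ)) ≠ 0} := by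
    -- A nonzero prime field scalar leaves the vanishing of the trace unchanged.
    have h1 : ∀ x c, h (g (x, c)) = h x := by
      rintro x c
      have : a * (g (x, c) : Fˣ) = (c : ZMod p) • (a * (x : Fˣ) : F) := by
        simp [g, Algebra.smul_def]
        ring
      simp [h, this, Units.ne_zero]
    rw [Fintype.sum_prod_type]
    simp_rw [h1]
    have h2 : ∑ x : Subgroup.zpowers (α ^ N), h x = ∑ i : Fin n, h ((α ^ N) ^ (i : ℕ)) := by
      symm
      refine Fintype.sum_equiv
        ((finCongr hordN.symm).trans (finEquivZPowers (isOfFinOrder_of_finite (α ^ N)))) _ _ ?_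
      intro i
      simp only [Equiv.trans_apply, finCongr_apply, finEquivZPowers_apply, Fin.val_cast]
    simp only [sum_const, card_univ, ZMod.card_units, nsmul_eq_mul, ← mul_sum, h2]
    rw [Nat.cast_sub hp1.le]
    simp [h, card_filter, ite_not]
  rw [hA, hB, Fintype.card_prod, Fintype.card_units (α := F), ← hnN, ZMod.card_units,
    Fintype.card_zpowers, hordN] at key
  push_cast [Nat.cast_sub hp1.le] at key
  have hne : (n : ℤ) * ((p : ℤ) - 1) ≠ 0 := mul_ne_zero (by positivity) (by omega)
  have := mul_left_cancel₀ hne (key.trans (by ring :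
    _ = (n : ℤ) * ((p : ℤ) - 1) * (N *
      #{i : Fin n | Algebra.trace (ZMod p) F (a * ((α : F) ^ N) ^ (i : ℕ)) ≠ 0})))
  zify
  linarith

/-! ### Support sizes from sums of weights. -/

theorem card_erase_zero {K : Type*} [Field K] [Fintype K] {n r : ℕ}
    (U : Submodule K (Fin n → K)) [Fintype U] [DecidableEq U]
    (hr : Module.finrank K U = r) :
    #(univ.erase (0 : U)) = Fintype.card K ^ r - 1 := by
  rw [card_erase_of_mem (mem_univ _), card_univ, ← hr, Module.card_eq_pow_finrank (K := K)]

section Support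

variable {K : Type*} [Field K] [Fintype K] [DecidableEq K]

/-- A nonzero functional is surjective, so it takes all values equally often. -/
theorem card_mul_card_linearMap_ne_zero {V : Type*} [AddCommGroup V] [Module K V] [Fintype V]
    (φ : V →ₗ[K] K) (hφ : φ ≠ 0) :
    Fintype.card K * #{x | φ x ≠ 0} = Fintype.card V * (Fintype.card K - 1) := by
  have hs : Function.Surjective φ := LinearMap.surjective hφ
  have hrange : (AddMonoidHom.toMultiplicative φ.toAddMonoidHom).range =
      (MonoidHom.id (Multiplicative K)).range := by
    rw [MonoidHom.range_eq_top.2 hs, MonoidHom.range_eq_top.2 Function.surjective_id]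
  have := card_mul_sum_comp_eq_of_range_eq (R := ℕ) _ _ hrange
    fun x => if x.toAdd ≠ 0 then 1 else 0
  rw [Nat.cast_id, Nat.cast_id, Fintype.card_multiplicative, Fintype.card_multiplicative] at this
  have h1 : #{x : K | x ≠ 0} = Fintype.card K - 1 := by
    rw [filter_ne' univ 0, card_erase_of_mem (mem_univ _), card_univ]
  rw [← h1, card_filter, card_filter]
  refine Eq.trans (congrArg _ ?_) (this.trans (congrArg _ ?_))
  · exact Fintype.sum_equiv Multiplicative.ofAdd _ _ fun _ => rfl
  · exact Fintype.sum_equiv Multiplicative.toAdd _ _ fun _ => rfl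

/-- The weights of the words of a code count every coordinate of the support
`(1 - 1/|K|)·|U|` times. -/
theorem card_mul_sum_weight {n : ℕ} (U : Submodule K (Fin n → K)) [Fintype U] :
    Fintype.card K * ∑ x : U, #{i | (x : Fin n → K) i ≠ 0} =
      Fintype.card U * (Fintype.card K - 1) * (codeSupport U).ncard := by
  classical
  have h1 : ∀ i, Fintype.card K * #{x : U | (x : Fin n → K) i ≠ 0} =
      if i ∈ codeSupport U then Fintype.card U * (Fintype.card K - 1) else 0 := by
    intro i
    split_ifs with hi
    · refine card_mul_card_linearMap_ne_zero ((LinearMap.proj i).comp U.subtype) fun h => ?_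
      obtain ⟨x, hx, hxi⟩ := hi
      exact hxi (LinearMap.congr_fun h ⟨x, hx⟩)
    · rw [filter_eq_empty_iff.2, card_empty, mul_zero]
      exact fun x _ hx => hi ⟨x, x.2, hx⟩
  simp_rw [card_filter]
  rw [sum_comm, mul_sum]
  simp_rw [← card_filter, h1]
  rw [← sum_filter, sum_const, smul_eq_mul, mul_comm, Set.ncard_eq_toFinset_card']
  congr 2
  ext
  simp

theorem sum_erase_zero_weight {n c r : ℕ} (U : Submodule K (Fin n → K)) [Fintype U]
    [DecidableEq U] (hr : Module.finrank K U = r) :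
    ∑ x ∈ univ.erase (0 : U), Fintype.card K * (c * #{i | (x : Fin n → K) i ≠ 0}) =
      c * (Fintype.card K ^ r * (Fintype.card K - 1) * (codeSupport U).ncard) := by
  have hU : Fintype.card U = Fintype.card K ^ r := by
    rw [← hr, Module.card_eq_pow_finrank (K := K)]
  rw [← hU, ← card_mul_sum_weight, mul_left_comm, mul_sum, mul_sum]
  exact sum_erase _ (by simp)

theorem le_mul_ncard_codeSupport {n v c r : ℕ} (U : Submodule K (Fin n → K))
    (hr : Module.finrank K U = r)
    (h : ∀ x ∈ U, x ≠ 0 → v ≤ Fintype.card K * (c * #{i | x i ≠ 0})) :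
    (Fintype.card K ^ r - 1) * v ≤
      c * (Fintype.card K ^ r * (Fintype.card K - 1) * (codeSupport U).ncard) := by
  classical
  rw [← sum_erase_zero_weight U hr, ← card_erase_zero U hr, ← smul_eq_mul, ← sum_const]
  exact sum_le_sum fun x hx => h x x.2 (by simpa using hx)

theorem eq_mul_ncard_codeSupport {n v c r : ℕ} (U : Submodule K (Fin n → K))
    (hr : Module.finrank K U = r)
    (h : ∀ x ∈ U, x ≠ 0 → v = Fintype.card K * (c * #{i | x i ≠ 0})) :
    (Fintype.card K ^ r - 1) * v =
      c * (Fintype.card K ^ r * (Fintype.card K - 1) * (codeSupport U).ncard) := by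
  classical
  rw [← sum_erase_zero_weight U hr, ← card_erase_zero U hr, ← smul_eq_mul, ← sum_const]
  exact sum_congr rfl fun x hx => h x x.2 (by simpa using hx)

end Support

/-! ### The extremal subspace. -/

/-- A subspace of any dimension `r ≤ l` none of whose nonzero elements is a cube: a translate of a
subspace of the subfield with `p ^ l` elements. -/
theorem exists_submodule_not_cube {p : ℕ} [Fact p.Prime] {F : Type*} [Field F] [Fintype F]
    [Algebra (ZMod p) F] (hp : p ≡ 2 [MOD 3]) {l r : ℕ} (hl : Odd l)
    (hlF : l ∣ Module.finrank (ZMod p) F) (hrl : r ≤ l) {α : F} (hα : ¬ ∃ b, b ^ 3 = α) :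
    ∃ H : Submodule (ZMod p) F, Module.finrank (ZMod p) H = r ∧
      ∀ x ∈ H, x ≠ 0 → ¬ ∃ b, b ^ 3 = x := by
  have hl0 : l ≠ 0 := hl.pos.ne'
  have hα0 : α ≠ 0 := by
    rintro rfl
    exact hα ⟨0, by simp⟩
  have hfin := GaloisField.finrank p hl0
  obtain ⟨φ⟩ := FiniteField.nonempty_algHom_of_finrank_dvd (F := ZMod p) (K := GaloisField p l)
    (L := F) (by rwa [hfin])
  obtain ⟨f, hf⟩ := exists_linearIndependent_of_le_finrank (R := ZMod p)
    (M := GaloisField p l) (n := r) (by rwa [hfin])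
  have hcop : (Nat.card (GaloisField p l)ˣ).Coprime 3 := by
    rw [Nat.card_units, GaloisField.card p l hl0, Nat.coprime_comm,
      Nat.Prime.coprime_iff_not_dvd Nat.prime_three]
    intro h
    have h1 : p ^ l ≡ 2 [MOD 3] := by
      obtain ⟨k, rfl⟩ := hl
      have := ((hp.pow 2).pow k).mul hp
      rw [pow_succ, pow_mul]
      refine this.trans ?_
      have h4 : (2 ^ 2) ^ k ≡ 1 ^ k [MOD 3] := Nat.ModEq.pow k rfl
      simpa using h4.mul_right 2
    have h1' : p ^ l % 3 = 2 := h1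
    omega
  let ψ : GaloisField p l →ₗ[ZMod p] F := (LinearMap.mulLeft (ZMod p) α).comp φ.toLinearMap
  have hψ : Function.Injective ψ := fun x y h =>
    φ.injective (mul_left_cancel₀ hα0 h)
  refine ⟨(Submodule.span (ZMod p) (Set.range f)).map ψ, ?_, ?_⟩
  · rw [← (Submodule.equivMapOfInjective ψ hψ _).finrank_eq, finrank_span_eq_card hf, Fintype.card_fin]
  · rintro _ ⟨x, -, rfl⟩ hx ⟨b, hb⟩
    obtain ⟨y, rfl⟩ := exists_pow_eq_of_coprime_card three_ne_zero hcop x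
    have hb' : b ^ 3 = α * φ y ^ 3 := by rw [hb]; simp [ψ]
    have hy : φ y ≠ 0 := by
      intro h
      apply hx
      simp [ψ, h]
    exact hα ⟨b / φ y, by rw [div_pow, hb']; field_simp⟩

/-! ### The generalized Hamming weights. -/

theorem mainTheorem11 (p m n₁ N l r : ℕ) [Fact p.Prime] (hp_odd : Odd p)
    (F : Type*) [Field F] [Fintype F] [Algebra (ZMod p) F] (hF : Fintype.card F = p ^ m)
    (hn₁ : 0 < n₁) (hcop : Nat.Coprime n₁ p)
    (hm : IsLeast {k : ℕ | 0 < k ∧ p ^ k ≡ 1 [MOD n₁]} m)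
    (hN : N = (p ^ m - 1) / n₁)
    (α : Fˣ) (hα : ∀ x : Fˣ, x ∈ Subgroup.zpowers α)
    (θ : F) (hθ : θ = (α : F) ^ N)
    (hN₁ : Nat.gcd N ((p ^ m - 1) / (p - 1)) = 3)
    (hp : p ≡ 2 [MOD 3]) (hl : Odd l) (hlm : 4 * l ∣ m)
    (hr₁ : 1 ≤ r) (hrl : r ≤ l) :
    (genHammingWeight (traceCode (ZMod p) (fun i : Fin n₁ => θ ^ (i : ℕ))) r : ℝ) =
      (1 - 1 / (p : ℝ) ^ r) * (((p : ℝ) ^ m - Real.sqrt ((p : ℝ) ^ m)) / (N : ℝ)) := by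
  classical
  have hp1 : 1 < p := (Fact.out : p.Prime).one_lt
  obtain ⟨t, rfl⟩ := hlm
  obtain ⟨Q, hQdef⟩ : ∃ Q, Q = p ^ (2 * l * t) := ⟨_, rfl⟩
  have hQm : p ^ (4 * l * t) = Q ^ 2 := by rw [hQdef, ← pow_mul]; ring_nf
  have hQ : Fintype.card F = Q ^ 2 := hF.trans hQm
  have hQ3 : Q ≡ 1 [MOD 3] := by
    rw [hQdef, mul_assoc, pow_mul]
    have h4 : (2 ^ 2) ^ (l * t) ≡ 1 ^ (l * t) [MOD 3] := Nat.ModEq.pow _ rfl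
    simpa using ((hp.pow 2).pow (l * t)).trans h4
  have hQ1 : 1 < Q := by
    have : 1 < Q ^ 2 := hQ ▸ Fintype.one_lt_card
    by_contra h
    have : Q ^ 2 ≤ 1 ^ 2 := Nat.pow_le_pow_left (not_lt.1 h) 2
    omega
  have hnN : n₁ * N = Fintype.card F - 1 := by
    rw [hN, hF]
    exact Nat.mul_div_cancel' ((Nat.modEq_iff_dvd' (Nat.one_le_pow _ _ hp1.pos)).1 hm.1.2.symm)
  have hN0 : 0 < N := by
    have := Fintype.one_lt_card (α := F)
    exact Nat.pos_of_mul_pos_left (by omega : 0 < n₁ * N)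
  have hfin : Module.finrank (ZMod p) F = 4 * l * t := by
    have := FiniteField.pow_finrank_eq_card p F
    exact Nat.pow_right_injective hp1 (this.trans hF)
  -- Otherwise the two values `-2Q` and `Q` would coincide.
  have hαc : ¬ ∃ b, b ^ 3 = (α : F) := by
    rintro ⟨b, hb⟩
    have hb0 : b ≠ 0 := by
      rintro rfl
      exact α.ne_zero (by rw [← hb]; simp)
    obtain ⟨h1, h2⟩ := cubicSum_values hp hQ hQ3 hα
    rw [← hb, ← one_mul (b ^ 3), cubicSum_mul_cube p 1 hb0, h1] at h2
    have : (Q : ℂ) = 0 := by linear_combination (-1 / 3 : ℂ) * h2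
    have : Q = 0 := by exact_mod_cast this
    omega
  let w : F →ₗ[ZMod p] (Fin n₁ → ZMod p) := LinearMap.pi fun i =>
    (Algebra.trace (ZMod p) F).comp (LinearMap.mulRight (ZMod p) (θ ^ (i : ℕ)))
  have hw : ∀ a, N * #{i | w a i ≠ 0} + cubicZeros p a = Q ^ 2 := fun a => by
    have := mul_card_trace_ne_zero_add_cubicZeros hp hn₁ hnN hα (by rwa [hF]) a
    rw [← hθ, hQ] at this
    exact this
  -- `v` is `p * N` times the minimal weight; clearing denominators keeps the comparison in `ℕ`.
  obtain ⟨v, hv⟩ : ∃ v : ℕ, (v : ℤ) = ((p : ℤ) - 1) * ((Q : ℤ) ^ 2 - Q) := by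
    refine ⟨(p - 1) * (Q ^ 2 - Q), ?_⟩
    push_cast [Nat.cast_sub hp1.le, Nat.cast_sub (Nat.le_self_pow two_ne_zero Q)]
    rfl
  have hvpos : 0 < v := by
    zify
    rw [hv]
    have : (1 : ℤ) < p := by exact_mod_cast hp1
    have : (1 : ℤ) < Q := by exact_mod_cast hQ1
    exact mul_pos (by linarith) (by nlinarith)
  have hle : ∀ a, a ≠ 0 → v ≤ Fintype.card (ZMod p) * (N * #{i | w a i ≠ 0}) := by
    intro a ha
    have h1 := mul_cubicZeros_le hp hQ hQ3 hα ha
    have h2 : (N : ℤ) * #{i | w a i ≠ 0} + cubicZeros p a = Q ^ 2 := by exact_mod_cast hw a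
    rw [ZMod.card]
    zify
    rw [hv, eq_sub_of_add_eq h2]
    linarith
  have heq : ∀ a, (¬ ∃ b, b ^ 3 = a) →
      v = Fintype.card (ZMod p) * (N * #{i | w a i ≠ 0}) := by
    intro a ha
    have h1 := mul_cubicZeros_of_not_cube hp hQ hQ3 hα ha
    have h2 : (N : ℤ) * #{i | w a i ≠ 0} + cubicZeros p a = Q ^ 2 := by exact_mod_cast hw a
    rw [ZMod.card]
    zify
    rw [hv, eq_sub_of_add_eq h2]
    linarith
  have hw0 : ∀ a, a ≠ 0 → w a ≠ 0 := by
    intro a ha h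
    have := hle a ha
    simp [h] at this
    omega
  -- Positive minimal weight makes encoding injective, so dimensions are preserved.
  have hwinj : Function.Injective w := by
    rw [← LinearMap.ker_eq_bot, LinearMap.ker_eq_bot']
    exact fun a ha => by_contra fun h => hw0 a h ha
  obtain ⟨H, hHr, hH⟩ := exists_submodule_not_cube hp hl (r := r)
    (hfin ▸ ⟨4 * t, by ring⟩) hrl hαc
  let C := traceCode (ZMod p) (fun i : Fin n₁ => θ ^ (i : ℕ))
  have hUC : H.map w ≤ C := LinearMap.map_le_range
  have hUr : Module.finrank (ZMod p) (H.map w) = r := by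
    rw [← (Submodule.equivMapOfInjective w hwinj H).finrank_eq, hHr]
  obtain ⟨⟨V, hVC, hVr, hVs⟩, hmin⟩ :=
    genHammingWeight_isLeast C r (hUr ▸ Submodule.finrank_mono hUC)
  have hmin' := hmin ⟨H.map w, hUC, hUr, rfl⟩
  have hlow := le_mul_ncard_codeSupport (v := v) (c := N) V hVr (by
    intro x hx hx0
    obtain ⟨a, rfl⟩ := hVC hx
    refine hle a ?_
    rintro rfl
    exact hx0 (map_zero _))
  have hupp := eq_mul_ncard_codeSupport (v := v) (c := N) (H.map w) hUr (by
    rintro _ ⟨a, ha, rfl⟩ hx0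
    refine heq a (hH a ha ?_)
    rintro rfl
    exact hx0 (map_zero _))
  rw [hVs] at hlow
  have hfinal : (p ^ r - 1) * v = N * (p ^ r * (p - 1) * genHammingWeight C r) := by
    rw [ZMod.card] at hlow hupp
    refine le_antisymm hlow ?_
    rw [hupp]
    gcongr
  have hsqrt : Real.sqrt ((p : ℝ) ^ (4 * l * t)) = Q := by
    rw [Real.sqrt_eq_iff_mul_self_eq (by positivity) (by positivity), ← sq]
    exact_mod_cast hQm
  have hvR : (v : ℝ) = ((p : ℝ) - 1) * ((Q : ℝ) ^ 2 - Q) := by exact_mod_cast hv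
  have hfR : ((p : ℝ) ^ r - 1) * v = N * (p ^ r * (p - 1) * genHammingWeight C r) := by
    have := congrArg (Nat.cast : ℕ → ℝ) hfinal
    push_cast [Nat.cast_sub hp1.le, Nat.cast_sub (Nat.one_le_pow r p hp1.pos)] at this
    exact this
  have hpR : (p : ℝ) - 1 ≠ 0 := sub_ne_zero.2 (by exact_mod_cast hp1.ne')
  have hp0 : (p : ℝ) ≠ 0 := by exact_mod_cast (by omega : p ≠ 0)
  have hNR : (N : ℝ) ≠ 0 := by exact_mod_cast hN0.ne'
  have hqR : (p : ℝ) ^ (4 * l * t) = (Q : ℝ) ^ 2 := by exact_mod_cast hQm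
  rw [hsqrt, hqR]
  change (genHammingWeight C r : ℝ) = _
  rw [hvR] at hfR
  field_simp
  refine mul_left_cancel₀ hpR ?_
  linear_combination -hfR
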